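/- Let $c\neq 0$ and let $\tilde M^n(4c)$ be a complex space form of complex dimension $n\ge 1$, i.e. a Kähler manifold (metric $\langle\,,\rangle$, complex structure $J$) of constant holomorphic sectional curvature $4c$, such as $\mathbb{C}P^n(4c)$ for $c>0$ or $\mathbb{C}H^n(4c)$ for $c<0$. Let $M$ be a (smoothly immersed) real hypersurface of $\tilde M^n(4c)$ with the induced metric. At a point $p\in M$ let $N$ be a unit normal vector and $A$ the corresponding shape operator, so that $\langle AX,Y\rangle=\langle\tilde\nabla_XY,N\rangle$ for the Levi-Civita connection $\tilde\nabla$ of $\tilde M^n(4c)$. Let $H=\frac{\mathrm{Tr}(A)}{2n-1}N$ be the mean curvature vector, $\kappa_X=\langle AX,X\rangle$ the normal curvature in the direction of a unit vector $X\in T_pM$, $\phi X$ the tangential component of $JX$, and $\mathrm{Ric}(X)=\mathrm{Tr}\,(Y\mapsto R(Y,X)X)$ the Ricci curvature of $M$, with $R(X,Y)Z=\nabla_X\nabla_YZ-\nabla_Y\nabla_XZ-\nabla_{[X,Y]}Z$ for the Levi-Civita connection $\nabla$ of $M$. Then for every $p\in M$ and every unit vector $X\in T_pM$, $$\mathrm{Ric}(X)\le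 \frac{(2n-1)^2}{8}\|H\|^2+\kappa_X^2+c\,(2n-2+3\|\phi X\|^2).$$ Equality holds if and only if there exist an orthonormal basis $\{e_1,\dots,e_{2n-1}\}$ of $T_pM$ with $e_{2n-1}=X$, a symmetric $(2n-2)\times(2n-2)$ matrix $B$ and a real number $\mu$ such that $A$ is represented in this basis by the matrix $$\begin{pmatrix} B & 0\\ 0 & \mu\end{pmatrix}\qquad\text{with}\qquad \mathrm{Tr}(B)=3\mu .$$ -/

import Mathlib

set_option maxSynthPendingDepth 3

open scoped Manifold ContDiff

noncomputable section

namespace RealHypersurface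

/-! ### Riemannian geometry in coordinates

`E` is a finite-dimensional real vector space and `G : E → E →L[ℝ] E →L[ℝ] ℝ` a field of bilinear
forms on (an open part of) it: the coefficients `G y u v = g_y(u, v)` of a metric in a chart. -/

section Coordinates

variable {E : Type*} [NormedAddCommGroup E] [NormedSpace ℝ E]

/-- Christoffel symbols of the first kind:
`Γ_y(u, v; w) = (D_u G(v, w) + D_v G(u, w) - D_w G(u, v)) / 2` at `y`
(see `christoffelLower_apply`). -/
def christoffelLower (G : E → E →L[ℝ] E →L[ℝ] ℝ) (y : E) : E →L[ℝ] E →L[ℝ] E →L[ℝ] ℝ :=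
  (1 / 2 : ℝ) • (fderiv ℝ G y + (fderiv ℝ G y).flip -
    (ContinuousLinearMap.comp (ContinuousLinearMap.flipₗᵢ ℝ E E ℝ).toContinuousLinearEquiv
      (fderiv ℝ G y).flip : E →L[ℝ] E →L[ℝ] E →L[ℝ] ℝ))

theorem christoffelLower_apply (G : E → E →L[ℝ] E →L[ℝ] ℝ) (y u v w : E) :
    christoffelLower G y u v w =
      (1 / 2 : ℝ) * (fderiv ℝ G y u v w + fderiv ℝ G y v u w - fderiv ℝ G y w u v) := by
  simp [christoffelLower]

/-- Christoffel symbols of the second kind: `christoffel G y u v` is the vector `Γ_y(u, v)` with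
`G y (Γ_y(u, v)) w = Γ_y(u, v; w)` for all `w`, i.e. the Levi-Civita derivative `∇_u v` at `y` of
the constant vector field `v`. -/
def christoffel (G : E → E →L[ℝ] E →L[ℝ] ℝ) (y : E) : E →L[ℝ] E →L[ℝ] E :=
  (ContinuousLinearMap.compL ℝ E (E →L[ℝ] ℝ) E (G y).inverse) ∘L christoffelLower G y

/-- The linear map `u ↦ R(u, v)w`, where
`R(u, v)w = ∇_u ∇_v w - ∇_v ∇_u w = D_u Γ(v, w) - D_v Γ(u, w) + Γ(u, Γ(v, w)) - Γ(v, Γ(u, w))`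
is the curvature tensor at `y` of the Levi-Civita connection (see `coordCurvature_apply`). -/
def coordCurvature (G : E → E →L[ℝ] E →L[ℝ] ℝ) (y v w : E) : E →ₗ[ℝ] E :=
  (((fderiv ℝ (christoffel G) y).flip v).flip w - (fderiv ℝ (christoffel G) y v).flip w
    + (christoffel G y).flip (christoffel G y v w)
    - (christoffel G y v) ∘L (christoffel G y).flip w : E →L[ℝ] E)

theorem coordCurvature_apply (G : E → E →L[ℝ] E →L[ℝ] ℝ) (y u v w : E) :
    coordCurvature G y v w u =
      fderiv ℝ (christoffel G) y u v w - fderiv ℝ (christoffel G) y v u w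
        + christoffel G y u (christoffel G y v w) - christoffel G y v (christoffel G y u w) := by
  simp [coordCurvature]

end Coordinates

/-! ### Metrics on manifolds

For a manifold `M` modelled on `E`, Mathlib's tangent space at `p` is a copy of `E`, a tangent
vector being represented by its coordinates in the preferred chart `extChartAt 𝓘(ℝ, E) p` at `p`.
So tensors at `p` may be computed in that chart, at the coordinates of `p`. -/

section Manifold

variable {E : Type*} [NormedAddCommGroup E] [NormedSpace ℝ E]
  {M : Type*} [TopologicalSpace M] [ChartedSpace E M]

variable (E M) in
/-- Fields of bilinear forms on the tangent spaces of `M`. -/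
abbrev FormField : Type _ :=
  ∀ x : M, TangentSpace 𝓘(ℝ, E) x →L[ℝ] TangentSpace 𝓘(ℝ, E) x →L[ℝ] ℝ

/-- The coefficients of `g` in the preferred chart at `p`: the pull-back of `g` by the inverse of
that chart. -/
def metricInChart (g : FormField E M) (p : M) (y : E) : E →L[ℝ] E →L[ℝ] ℝ :=
  ContinuousLinearMap.bilinearComp (E := E) (F := E) (E' := E) (F' := E)
    (g ((extChartAt 𝓘(ℝ, E) p).symm y))
    (mfderiv 𝓘(ℝ, E) 𝓘(ℝ, E) (extChartAt 𝓘(ℝ, E) p).symm y)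
    (mfderiv 𝓘(ℝ, E) 𝓘(ℝ, E) (extChartAt 𝓘(ℝ, E) p).symm y)

/-- The Riemannian curvature tensor `R(u, v)w` of the metric `g` at `p`. -/
def riemann (g : FormField E M) (p : M) (u v w : TangentSpace 𝓘(ℝ, E) p) :
    TangentSpace 𝓘(ℝ, E) p :=
  coordCurvature (metricInChart g p) (extChartAt 𝓘(ℝ, E) p p) v w u

/-- The Ricci curvature `Ric(X) = Tr (Y ↦ R(Y, X)X)` of the metric `g` in the direction `X`. -/
def ricci (g : FormField E M) (p : M) (X : TangentSpace 𝓘(ℝ, E) p) : ℝ :=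
  LinearMap.trace ℝ E (coordCurvature (metricInChart g p) (extChartAt 𝓘(ℝ, E) p p) X X)

end Manifold

/-! ### Complex space forms -/

section SpaceForm

variable {V : Type*} [NormedAddCommGroup V] [NormedSpace ℂ V]
  {N : Type*} [TopologicalSpace N] [ChartedSpace V N]

/-- The almost complex structure `J` of a complex manifold: multiplication by `i` in holomorphic
charts. -/
def complexStr {x : N} (v : TangentSpace 𝓘(ℝ, V) x) : TangentSpace 𝓘(ℝ, V) x :=
  HSMul.hSMul (β := V) (γ := V) Complex.I v

/-- A Riemannian metric `g` on a complex manifold `N` is a Kähler metric of constant holomorphic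
sectional curvature `4c`. -/
structure IsComplexSpaceForm (c : ℝ) (g : FormField V N) : Prop where
  /-- `g` is Hermitian. -/
  hermitian : ∀ (x : N) (u v : TangentSpace 𝓘(ℝ, V) x),
    g x (complexStr u) (complexStr v) = g x u v
  /-- `J` is parallel for the Levi-Civita connection: `∇_u (J v) = J (∇_u v)` for the coordinate
  vector fields `v` of every preferred chart. -/
  parallel : ∀ (p : N), ∀ y ∈ (extChartAt 𝓘(ℝ, V) p).target, ∀ u v : V,
    christoffel (metricInChart g p) y u (Complex.I • v) =
      Complex.I • christoffel (metricInChart g p) y u v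
  /-- Every `J`-invariant plane has sectional curvature `4c`. -/
  holSec : ∀ (x : N) (u : TangentSpace 𝓘(ℝ, V) x),
    g x (riemann g x u (complexStr u) (complexStr u)) u = 4 * c * (g x u u) ^ 2

end SpaceForm

/-! ### Hypersurfaces

`f : M → N` is an immersion of codimension one into a manifold with metric `g`. -/

section Hypersurface

variable {E : Type*} [NormedAddCommGroup E] [NormedSpace ℝ E]
  {M : Type*} [TopologicalSpace M] [ChartedSpace E M]
  {V : Type*} [NormedAddCommGroup V] [NormedSpace ℝ V]
  {N : Type*} [TopologicalSpace N] [ChartedSpace V N]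

/-- The induced metric `f^* g`. -/
def inducedMetric (g : FormField V N) (f : M → N) : FormField E M := fun p =>
  ContinuousLinearMap.bilinearComp (E := V) (F := V) (E' := E) (F' := E)
    (g (f p)) (mfderiv 𝓘(ℝ, E) 𝓘(ℝ, V) f p) (mfderiv 𝓘(ℝ, E) 𝓘(ℝ, V) f p)

/-- `η` is a unit normal vector of the hypersurface `f` at `p`. -/
def IsUnitNormal (g : FormField V N) (f : M → N) (p : M) (η : TangentSpace 𝓘(ℝ, V) (f p)) :
    Prop :=
  g (f p) η η = 1 ∧
    ∀ v : TangentSpace 𝓘(ℝ, E) p, g (f p) η (mfderiv 𝓘(ℝ, E) 𝓘(ℝ, V) f p v) = 0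

/-- The ambient Levi-Civita derivative `∇̃_u (df v)` at `p`, where `v` is extended by the vector
field with constant coordinates in the chart at `p`: with `F` the coordinate expression of `f` this
is `D²F(u, v) + Γ̃(DF u, DF v)`. -/
def ambientDeriv (g : FormField V N) (f : M → N) (p : M) : E →L[ℝ] E →L[ℝ] V :=
  fderiv ℝ (fderiv ℝ (writtenInExtChartAt 𝓘(ℝ, E) 𝓘(ℝ, V) p f)) (extChartAt 𝓘(ℝ, E) p p) +
    (christoffel (metricInChart g (f p)) (extChartAt 𝓘(ℝ, V) (f p) (f p))).bilinearComp
      (fderiv ℝ (writtenInExtChartAt 𝓘(ℝ, E) 𝓘(ℝ, V) p f) (extChartAt 𝓘(ℝ, E) p p))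
      (fderiv ℝ (writtenInExtChartAt 𝓘(ℝ, E) 𝓘(ℝ, V) p f) (extChartAt 𝓘(ℝ, E) p p))

/-- The scalar second fundamental form `(u, v) ↦ ⟨∇̃_u (df v), η⟩` at `p` in the direction of the
normal vector `η`. -/
def secondForm (g : FormField V N) (f : M → N) (p : M) (η : TangentSpace 𝓘(ℝ, V) (f p)) :
    E →L[ℝ] E →L[ℝ] ℝ :=
  (ContinuousLinearMap.compL ℝ E V ℝ (g (f p) η)) ∘L ambientDeriv g f p

/-- The shape operator `A` at `p` for the unit normal `η`. By the Gauss formula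
`∇̃_u v = ∇_u v + ⟨A u, v⟩ η` it is the operator with `⟨A u, v⟩ = ⟨∇̃_u v, η⟩`. -/
def shapeOp (g : FormField V N) (f : M → N) (p : M) (η : TangentSpace 𝓘(ℝ, V) (f p)) :
    TangentSpace 𝓘(ℝ, E) p →ₗ[ℝ] TangentSpace 𝓘(ℝ, E) p :=
  ContinuousLinearMap.toLinearMap (M := E) (M₂ := E)
    (ContinuousLinearMap.inverse (M := E) (M₂ := E →L[ℝ] ℝ) (inducedMetric g f p) ∘L
      secondForm g f p η)

/-- The mean curvature vector `H = (Tr A / dim M) η`. -/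
def meanCurvature (g : FormField V N) (f : M → N) (p : M) (η : TangentSpace 𝓘(ℝ, V) (f p)) :
    TangentSpace 𝓘(ℝ, V) (f p) :=
  (LinearMap.trace ℝ (TangentSpace 𝓘(ℝ, E) p) (shapeOp g f p η) / (Module.finrank ℝ E : ℝ)) • η

/-- The normal curvature `κ_X = ⟨A X, X⟩`. -/
def normalCurvature (g : FormField V N) (f : M → N) (p : M) (η : TangentSpace 𝓘(ℝ, V) (f p))
    (X : TangentSpace 𝓘(ℝ, E) p) : ℝ :=
  inducedMetric g f p (shapeOp g f p η X) X

end Hypersurface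

section HypersurfaceComplex

variable {E : Type*} [NormedAddCommGroup E] [NormedSpace ℝ E]
  {M : Type*} [TopologicalSpace M] [ChartedSpace E M]
  {V : Type*} [NormedAddCommGroup V] [NormedSpace ℂ V]
  {N : Type*} [TopologicalSpace N] [ChartedSpace V N]

/-- The tangential component `φX = JX - ⟨JX, η⟩ η` of `JX`, as a vector of the ambient tangent
space, in which `T_p M` is embedded by `df`. -/
def phi (g : FormField V N) (f : M → N) (p : M) (η : TangentSpace 𝓘(ℝ, V) (f p))
    (X : TangentSpace 𝓘(ℝ, E) p) : TangentSpace 𝓘(ℝ, V) (f p) :=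
  complexStr (mfderiv 𝓘(ℝ, E) 𝓘(ℝ, V) f p X) -
    g (f p) (complexStr (mfderiv 𝓘(ℝ, E) 𝓘(ℝ, V) f p X)) η • η

end HypersurfaceComplex

end RealHypersurface

end

open RealHypersurface

/-!
Write `A` for the shape operator, `κ = ⟨AX, X⟩` and `T = Tr A`. The trace of the Gauss equation
gives `Ric(X) = c (2n - 2 + 3 |φX|²) + κ T - |AX|²` (`trace_coordCurvature_pullback`), and
`T² / 8 + κ² - (κ T - |AX|²) = 2 (κ - T / 4)² + |AX - κ X|²` is nonnegative. It vanishes exactly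
when `AX = κ X` and `T = 4 κ`, that is, when `A` has the block form of the statement in an
orthonormal basis extending `X` (`ricci_inequality`). As `T² / 8 = (2n - 1)² |H|² / 8`, this is the
claim.

Two facts of Riemannian geometry are needed, and both are proved in coordinates, for a field `G` of
bilinear forms on a vector space which is a `C²` metric near a point (`IsMetricAt`).

* A Kähler metric of constant holomorphic sectional curvature `4c` satisfies
  `⟨R(u, v)v, u⟩ = c (|u|²|v|² - ⟨u, v⟩² + 3 ⟨Ju, v⟩²)`
  (`apply_coordCurvature_of_holomorphic`). The curvature symmetries come from torsion-freeness,
  metric compatibility and symmetry of second derivatives; differentiating `∇J = 0` shows that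
  `R(u, v)` commutes with `J`; the rest is polarisation (`sectional_of_holomorphic`).
* The Gauss equation (`gauss_equation`) for the pull-back metric `F^* G` of a map `F` whose
  differential is injective with one-dimensional cokernel.

The link with the manifolds is that, near the coordinates of `p`, the induced metric in the chart at
`p` is the pull-back of the ambient metric in the chart at `f p` by the coordinate expression of `f`
(`metricInChart_inducedMetric`), while at the base point of its own chart a metric is given by its
coefficients (`metricInChart_self`).
-/

/-! ### Metrics near a point of a vector space -/

namespace RealHypersurface

open Filter Topology

section MetricAt

variable {E : Type*} [NormedAddCommGroup E] [NormedSpace ℝ E]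
  {V : Type*} [NormedAddCommGroup V] [NormedSpace ℝ V]
  {W : Type*} [NormedAddCommGroup W] [NormedSpace ℝ W]

/-- `G` is, near `y`, the coefficient field of a Riemannian metric of class `C²`. -/
structure IsMetricAt (G : E → E →L[ℝ] E →L[ℝ] ℝ) (y : E) : Prop where
  contDiffAt : ContDiffAt ℝ 2 G y
  symm : ∀ᶠ z in 𝓝 y, ∀ u v, G z u v = G z v u
  pos : ∀ᶠ z in 𝓝 y, ∀ u, u ≠ 0 → 0 < G z u u

theorem isInvertible_of_pos [FiniteDimensional ℝ E] {b : E →L[ℝ] E →L[ℝ] ℝ}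
    (hb : ∀ u, u ≠ 0 → 0 < b u u) : b.IsInvertible := by
  have hinj : Function.Injective b := by
    rw [injective_iff_map_eq_zero]
    intro u hu
    by_contra h
    have := hb u h
    simp [hu] at this
  have hfin : Module.finrank ℝ E = Module.finrank ℝ (E →L[ℝ] ℝ) := by
    rw [← (LinearMap.toContinuousLinearMap (𝕜 := ℝ) (E := E) (F' := ℝ)).finrank_eq]
    exact (Subspace.dual_finrank_eq (K := ℝ) (V := E)).symm
  exact ⟨(LinearEquiv.ofInjectiveOfFinrankEq (b : E →ₗ[ℝ] E →L[ℝ] ℝ) hinj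
    hfin).toContinuousLinearEquiv, by ext; rfl⟩

theorem fderiv_bilin_apply {B : E → V →L[ℝ] V →L[ℝ] W} {α β : E → V} {y : E}
    (hB : DifferentiableAt ℝ B y) (hα : DifferentiableAt ℝ α y) (hβ : DifferentiableAt ℝ β y)
    (a : E) :
    fderiv ℝ (fun z => B z (α z) (β z)) y a =
      fderiv ℝ B y a (α y) (β y) + B y (fderiv ℝ α y a) (β y) + B y (α y) (fderiv ℝ β y a) := by
  rw [fderiv_clm_apply (hB.clm_apply hα) hβ, fderiv_clm_apply hB hα]
  simp
  abel

theorem fderiv_bilin_const_apply {B : E → V →L[ℝ] V →L[ℝ] W} {y : E} (hB : DifferentiableAt ℝ B y)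
    (u v : V) (a : E) : fderiv ℝ (fun z => B z u v) y a = fderiv ℝ B y a u v := by
  simp [fderiv_bilin_apply hB (differentiableAt_const _) (differentiableAt_const _)]

theorem fderiv_fderiv_symm {f : E → V} {y : E} (hf : ContDiffAt ℝ 2 f y) (a b : E) :
    fderiv ℝ (fderiv ℝ f) y a b = fderiv ℝ (fderiv ℝ f) y b a :=
  (hf.isSymmSndFDerivAt (by simp)) a b

namespace IsMetricAt

variable {G : E → E →L[ℝ] E →L[ℝ] ℝ} {y : E}

theorem eventually (h : IsMetricAt G y) : ∀ᶠ z in 𝓝 y, IsMetricAt G z := by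
  filter_upwards [h.contDiffAt.eventually (by decide), h.symm.eventually_nhds,
    h.pos.eventually_nhds] with z h1 h2 h3 using ⟨h1, h2, h3⟩

theorem symm_apply (h : IsMetricAt G y) (u v : E) : G y u v = G y v u := h.symm.self_of_nhds u v

theorem pos_apply (h : IsMetricAt G y) {u : E} (hu : u ≠ 0) : 0 < G y u u :=
  h.pos.self_of_nhds u hu

theorem differentiableAt (h : IsMetricAt G y) : DifferentiableAt ℝ G y :=
  h.contDiffAt.differentiableAt (by norm_num)

theorem contDiffAt_fderiv (h : IsMetricAt G y) : ContDiffAt ℝ 1 (fderiv ℝ G) y :=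
  h.contDiffAt.fderiv_right (by norm_num)

theorem fderiv_symm (h : IsMetricAt G y) (a u v : E) : fderiv ℝ G y a u v = fderiv ℝ G y a v u := by
  have e : (fun z => G z u v) =ᶠ[𝓝 y] fun z => G z v u := h.symm.mono fun z hz => hz u v
  have e' := DFunLike.congr_fun (e.fderiv_eq (𝕜 := ℝ)) a
  simpa [fderiv_bilin_const_apply h.differentiableAt] using e'

theorem ext_left (h : IsMetricAt G y) {u v : E} (huv : ∀ w, G y u w = G y v w) : u = v := by
  by_contra hne
  have := h.pos_apply (sub_ne_zero.2 hne)
  simp [huv] at this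

theorem coordCurvature_skew (u v w : E) :
    coordCurvature G y v w u = - coordCurvature G y u w v := by
  simp only [coordCurvature_apply]
  abel

variable [FiniteDimensional ℝ E]

theorem isInvertible (h : IsMetricAt G y) : (G y).IsInvertible :=
  isInvertible_of_pos fun _ => h.pos_apply

theorem apply_christoffel (h : IsMetricAt G y) (u v w : E) :
    G y (christoffel G y u v) w = christoffelLower G y u v w := by
  have : christoffel G y u v = (G y).inverse (christoffelLower G y u v) := by
    simp [christoffel]
  rw [this, h.isInvertible.self_apply_inverse]

/-- The Levi-Civita connection is torsion-free. -/
theorem christoffel_symm (h : IsMetricAt G y) (u v : E) :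
    christoffel G y u v = christoffel G y v u := by
  refine h.ext_left fun w => ?_
  rw [h.apply_christoffel, h.apply_christoffel, christoffelLower_apply, christoffelLower_apply,
    h.fderiv_symm w u v]
  ring

/-- The Levi-Civita connection is metric. -/
theorem fderiv_eq (h : IsMetricAt G y) (u v w : E) :
    fderiv ℝ G y u v w = G y (christoffel G y u v) w + G y v (christoffel G y u w) := by
  rw [h.symm_apply v, h.apply_christoffel, h.apply_christoffel, christoffelLower_apply,
    christoffelLower_apply, h.fderiv_symm u w v, h.fderiv_symm w u v, h.fderiv_symm v u w]
  ring

theorem differentiableAt_christoffel (h : IsMetricAt G y) :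
    DifferentiableAt ℝ (christoffel G) y := by
  have h1 : ContDiffAt ℝ 1 (fun z => (G z).inverse) y :=
    (h.isInvertible.contDiffAt_map_inverse (n := 1)).comp y (h.contDiffAt.of_le (by norm_num))
  have h2 : DifferentiableAt ℝ (christoffelLower G) y := by
    have hd : DifferentiableAt ℝ (fderiv ℝ G) y :=
      h.contDiffAt_fderiv.differentiableAt (by norm_num)
    have hd' : DifferentiableAt ℝ (fun z => (fderiv ℝ G z).flip) y :=
      (ContinuousLinearMap.flipₗᵢ ℝ E E (E →L[ℝ] ℝ)).differentiableAt.comp y hd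
    unfold christoffelLower
    fun_prop
  have h3 : DifferentiableAt ℝ (fun z => ContinuousLinearMap.compL ℝ E (E →L[ℝ] ℝ) E (G z).inverse)
      y := (ContinuousLinearMap.differentiableAt _).comp y (h1.differentiableAt (by norm_num))
  exact h3.clm_comp h2

theorem fderiv_christoffel_symm (h : IsMetricAt G y) (a u v : E) :
    fderiv ℝ (christoffel G) y a u v = fderiv ℝ (christoffel G) y a v u := by
  have e : (fun z => christoffel G z u v) =ᶠ[𝓝 y] fun z => christoffel G z v u :=
    h.eventually.mono fun z hz => hz.christoffel_symm u v
  have e' := DFunLike.congr_fun (e.fderiv_eq (𝕜 := ℝ)) a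
  simpa [fderiv_bilin_const_apply h.differentiableAt_christoffel] using e'

/-- First Bianchi identity. -/
theorem coordCurvature_bianchi (h : IsMetricAt G y) (u v w : E) :
    coordCurvature G y v w u + coordCurvature G y w u v + coordCurvature G y u v w = 0 := by
  simp only [coordCurvature_apply, h.fderiv_christoffel_symm _ w u,
    h.fderiv_christoffel_symm _ w v, h.fderiv_christoffel_symm _ u v, h.christoffel_symm w u,
    h.christoffel_symm w v, h.christoffel_symm u v]
  abel

theorem fderiv_fderiv_eq (h : IsMetricAt G y) (a u v w : E) :
    fderiv ℝ (fderiv ℝ G) y a u v w =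
      fderiv ℝ G y a (christoffel G y u v) w + G y (fderiv ℝ (christoffel G) y a u v) w +
      (fderiv ℝ G y a v (christoffel G y u w) + G y v (fderiv ℝ (christoffel G) y a u w)) := by
  have e : (fun z => fderiv ℝ G z u v w) =ᶠ[𝓝 y] fun z =>
      G z (christoffel G z u v) w + G z v (christoffel G z u w) :=
    h.eventually.mono fun z hz => hz.fderiv_eq u v w
  have e' := DFunLike.congr_fun (e.fderiv_eq (𝕜 := ℝ)) a
  have hG := h.differentiableAt
  have hΓ := h.differentiableAt_christoffel
  have hd : DifferentiableAt ℝ (fderiv ℝ G) y :=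
    h.contDiffAt_fderiv.differentiableAt (by norm_num)
  have hl : fderiv ℝ (fun z => fderiv ℝ G z u v w) y a = fderiv ℝ (fderiv ℝ G) y a u v w := by
    rw [fderiv_bilin_apply (B := fun z => fderiv ℝ G z u)
      (hd.clm_apply (differentiableAt_const _)) (differentiableAt_const _)
      (differentiableAt_const _), fderiv_clm_apply hd (differentiableAt_const _)]
    simp
  rw [hl] at e'
  rw [e', fderiv_fun_add (by fun_prop) (by fun_prop), add_apply,
    fderiv_bilin_apply hG (by fun_prop) (by fun_prop),
    fderiv_bilin_apply hG (by fun_prop) (by fun_prop), fderiv_bilin_const_apply hΓ,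
    fderiv_bilin_const_apply hΓ]
  simp

/-- `R(u, v)` is skew-symmetric: second derivatives of the metric coefficients commute. -/
theorem apply_coordCurvature_skew (h : IsMetricAt G y) (u v w z : E) :
    G y (coordCurvature G y v w u) z = - G y (coordCurvature G y v z u) w := by
  have h1 := h.fderiv_fderiv_eq u v w z
  have h2 := h.fderiv_fderiv_eq v u w z
  have h3 : fderiv ℝ (fderiv ℝ G) y u v w z = fderiv ℝ (fderiv ℝ G) y v u w z := by
    rw [fderiv_fderiv_symm h.contDiffAt]
  simp only [h.fderiv_eq] at h1 h2
  simp only [coordCurvature_apply, map_add, map_sub, add_apply,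
    sub_apply]
  have s := h.symm_apply
  rw [s (fderiv ℝ (christoffel G) y u v z) w, s (fderiv ℝ (christoffel G) y v u z) w,
    s (christoffel G y u (christoffel G y v z)) w, s (christoffel G y v (christoffel G y u z)) w]
  linarith

/-- Pair symmetry `⟨R(u, v)w, z⟩ = ⟨R(w, z)u, v⟩`. -/
theorem apply_coordCurvature_pair (h : IsMetricAt G y) (u v w z : E) :
    G y (coordCurvature G y v w u) z = G y (coordCurvature G y z u w) v := by
  have b : ∀ u v w z, G y (coordCurvature G y v w u) z + G y (coordCurvature G y w u v) z +
      G y (coordCurvature G y u v w) z = 0 := fun u v w z => by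
    simpa using congrArg (fun x => G y x z) (h.coordCurvature_bianchi u v w)
  have s : ∀ u v w z, G y (coordCurvature G y v w u) z = - G y (coordCurvature G y u w v) z :=
    fun u v w z => by rw [coordCurvature_skew]; simp
  have k := h.apply_coordCurvature_skew
  linarith [b u v w z, b v w z u, b w z u v, b z u v w, k u v w z, k v w u z, k w u v z,
    k v w z u, k w z v u, k z v w u, k w z u v, k z u w v, k u w z v, k z u v w, k u v z w,
    k v z u w, s u v w z, s v w u z, s w u v z, s u v z w, s v w z u, s w z u v, s z u v w,
    s w z v u, s u w z v, s v z u w, s z u w v, s u z v w, s v u w z, s z v w u, s z v u w]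

end IsMetricAt

end MetricAt

end RealHypersurface

/-! ### Kähler metrics of constant holomorphic sectional curvature -/

namespace RealHypersurface

open Filter Topology

/-- A Kähler curvature tensor of constant holomorphic sectional curvature `4c` has sectional
curvatures `R(u, v, v, u) = c (|u|²|v|² - ⟨u, v⟩² + 3⟨Ju, v⟩²)`. Polarising the hypothesis along
`x ± y` gives a relation between the sectional curvatures of `(x, y)` and `(x, Jy)`; the same
relation for `(x, Jy)` makes a linear system with a unique solution. -/
theorem sectional_of_holomorphic {V : Type*} [AddCommGroup V] [Module ℝ V] {c : ℝ} {J : V →ₗ[ℝ] V}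
    (hJ : ∀ x, J (J x) = -x) {b : V →ₗ[ℝ] V →ₗ[ℝ] ℝ} (hb : ∀ x y, b x y = b y x)
    (hbJ : ∀ x y, b (J x) (J y) = b x y) {R : V → V → V → V → ℝ}
    (hadd : ∀ x x' y z w, R (x + x') y z w = R x y z w + R x' y z w)
    (hskew : ∀ x y z w, R x y z w = - R y x z w)
    (hpair : ∀ x y z w, R x y z w = R z w x y)
    (hbianchi : ∀ x y z w, R x y z w + R y z x w + R z x y w = 0)
    (hRJ : ∀ x y z w, R x y (J z) (J w) = R x y z w)
    (hol : ∀ x, R x (J x) (J x) x = 4 * c * b x x ^ 2) (u v : V) :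
    R u v v u = c * (b u u * b v v - b u v ^ 2 + 3 * b (J u) v ^ 2) := by
  have hskew' : ∀ x y z w, R x y z w = - R x y w z := fun x y z w => by
    rw [hpair, hskew, hpair]
  have add2 : ∀ x y y' z w, R x (y + y') z w = R x y z w + R x y' z w := fun x y y' z w => by
    rw [hskew, hadd, hskew y, hskew y']; ring
  have add3 : ∀ x y z z' w, R x y (z + z') w = R x y z w + R x y z' w := fun x y z z' w => by
    rw [hpair, hadd, hpair z, hpair z']
  have add4 : ∀ x y z w w', R x y z (w + w') = R x y z w + R x y z w' := fun x y z w w' => by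
    rw [hskew', add3, hskew' x y w, hskew' x y w']; ring
  have neg3 : ∀ x y z w, R x y (-z) w = - R x y z w := fun x y z w => by
    have h0 : R x y 0 w = 0 := by simpa using add3 x y 0 0 w
    have := add3 x y z (-z) w
    rw [add_neg_cancel, h0] at this
    linarith
  have neg4 : ∀ x y z w, R x y z (-w) = - R x y z w := fun x y z w => by
    rw [hskew', neg3, hskew' x y w, neg_neg]
  have neg1 : ∀ x y z w, R (-x) y z w = - R x y z w := fun x y z w => by
    rw [hpair, neg3, hpair z]
  have neg2 : ∀ x y z w, R x (-y) z w = - R x y z w := fun x y z w => by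
    rw [hskew, neg1, hskew y, neg_neg]
  have hRJ' : ∀ x y z w, R (J x) (J y) z w = R x y z w := fun x y z w => by
    rw [hpair, hRJ, hpair]
  have hbJ' : ∀ x y, b x (J y) = - b (J x) y := fun x y => by
    rw [← hbJ x (J y), hJ]; simp
  have mv34 : ∀ x y z w, R x y (J z) w = - R x y z (J w) := fun x y z w => by
    rw [← hRJ x y z (J w), hJ, neg4, neg_neg]
  have mv12 : ∀ x y z w, R (J x) y z w = - R x (J y) z w := fun x y z w => by
    rw [← hRJ' x (J y), hJ, neg2, neg_neg]
  -- the `(2, 2)`-part of the polarised hypothesis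
  have main : ∀ x y, 6 * R x (J y) (J y) x + 2 * R x y y x =
      8 * c * (b x x * b y y) + 16 * c * b x y ^ 2 := fun x y => by
    have hp := hol (x + y)
    have hm := hol (x + -y)
    have hx := hol x
    have hy := hol y
    simp only [map_add, map_neg, LinearMap.add_apply, LinearMap.neg_apply, hadd, add2, add3, add4,
      neg1, neg2, neg3, neg4, hb y x] at hp hm
    have e1 : R y (J y) (J x) x = R x (J x) (J y) y := by
      rw [hpair, hskew, hskew', neg_neg]
    have e2 : R y (J x) (J x) y = R x (J y) (J y) x := by
      linarith [mv12 y x (J x) y, mv34 (J y) x x y, hskew (J y) x x (J y), hskew' x (J y) x (J y)]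
    have e3 : R y (J x) (J y) x = R x (J y) (J y) x := by
      linarith [mv34 y (J x) y x, hskew' y (J x) y (J x)]
    have e4 : R x (J y) (J x) y = R x (J y) (J y) x := by
      linarith [mv34 x (J y) x y, hskew' x (J y) x (J y)]
    have e5 : R x (J x) (J y) y = R x y y x + R x (J y) (J y) x := by
      linarith [hbianchi x (J x) (J y) y, hRJ' x y x y, hskew' x y x y, mv34 (J y) x x y,
        hskew (J y) x x (J y), hskew' x (J y) x (J y)]
    rw [e1, e2, e3, e4, e5] at hp hm
    linarith
  have h1 := main u v
  have h2 := main u (J v)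
  rw [hJ, neg2, neg3, neg_neg, hbJ, hbJ'] at h2
  linarith

section Kahler

variable {V : Type*} [NormedAddCommGroup V] [NormedSpace ℂ V]

/-- If `J` is parallel, the curvature operators commute with `J`. -/
theorem coordCurvature_I_smul {G : V → V →L[ℝ] V →L[ℝ] ℝ} {y : V} [FiniteDimensional ℝ V]
    (h : IsMetricAt G y)
    (hpar : ∀ᶠ z in 𝓝 y, ∀ u v, christoffel G z u (Complex.I • v) = Complex.I • christoffel G z u v)
    (u v w : V) :
    coordCurvature G y v (Complex.I • w) u = Complex.I • coordCurvature G y v w u := by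
  have hΓ := h.differentiableAt_christoffel
  have hd : ∀ a u w, fderiv ℝ (christoffel G) y a u (Complex.I • w) =
      Complex.I • fderiv ℝ (christoffel G) y a u w := fun a u w => by
    have e : (fun z => christoffel G z u (Complex.I • w)) =ᶠ[𝓝 y] fun z =>
        Complex.I • christoffel G z u w := hpar.mono fun z hz => hz u w
    have e' := DFunLike.congr_fun (e.fderiv_eq (𝕜 := ℝ)) a
    rw [fderiv_bilin_const_apply hΓ, fderiv_fun_const_smul (by fun_prop)] at e'
    rw [e', smul_apply, fderiv_bilin_const_apply hΓ]
  have hp := hpar.self_of_nhds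
  simp only [coordCurvature_apply, hd, hp, smul_sub, smul_add]

/-- The sectional curvatures of a Kähler metric of constant holomorphic sectional curvature. -/
theorem apply_coordCurvature_of_holomorphic [FiniteDimensional ℝ V] {c : ℝ}
    {G : V → V →L[ℝ] V →L[ℝ] ℝ} {y : V}
    (h : IsMetricAt G y)
    (hpar : ∀ᶠ z in 𝓝 y, ∀ u v, christoffel G z u (Complex.I • v) = Complex.I • christoffel G z u v)
    (hherm : ∀ u v, G y (Complex.I • u) (Complex.I • v) = G y u v)
    (hol : ∀ u, G y (coordCurvature G y (Complex.I • u) (Complex.I • u) u) u =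
      4 * c * G y u u ^ 2) (u v : V) :
    G y (coordCurvature G y v v u) u =
      c * (G y u u * G y v v - G y u v ^ 2 + 3 * G y (Complex.I • u) v ^ 2) := by
  let J : V →ₗ[ℝ] V := (LinearMap.lsmul ℂ V Complex.I).restrictScalars ℝ
  let b : V →ₗ[ℝ] V →ₗ[ℝ] ℝ := (G y).toLinearMap₁₂
  have hJ : ∀ x, J x = Complex.I • x := fun x => rfl
  have hb : ∀ x z, b x z = G y x z := fun x z => rfl
  have key := sectional_of_holomorphic (c := c) (J := J) (b := b)
    (R := fun x y' z w => G y (coordCurvature G y y' z x) w)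
    (fun x => by rw [hJ, hJ, smul_smul, Complex.I_mul_I, neg_one_smul])
    (fun x z => h.symm_apply x z) (fun x z => hherm x z)
    (fun x x' y z w => by simp)
    (fun x y z w => by rw [IsMetricAt.coordCurvature_skew]; simp)
    (fun x y z w => h.apply_coordCurvature_pair x y z w)
    (fun x y' z w => by
      simpa using congrArg (fun t => G y t w) (h.coordCurvature_bianchi x y' z))
    (fun x y z w => by rw [hJ, hJ, coordCurvature_I_smul h hpar, hherm])
    (fun x => hol x)
  exact key u v

end Kahler

end RealHypersurface

/-! ### The Gauss equation -/

namespace RealHypersurface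

open Filter Topology

section Gauss

variable {E : Type*} [NormedAddCommGroup E] [NormedSpace ℝ E]
  {V : Type*} [NormedAddCommGroup V] [NormedSpace ℝ V]

/-- A hyperplane `range T` and a unit normal `η` of it span the space. -/
theorem exists_eq_tangent_add_normal [FiniteDimensional ℝ E] [FiniteDimensional ℝ V]
    (hdim : Module.finrank ℝ V = Module.finrank ℝ E + 1) {b : V →L[ℝ] V →L[ℝ] ℝ}
    (hb : ∀ u v, b u v = b v u) {T : E →L[ℝ] V} (hT : Function.Injective T) {η : V}
    (h1 : b η η = 1) (h0 : ∀ v, b η (T v) = 0) (ξ : V) : ∃ e, ξ = T e + b ξ η • η := by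
  let S : E × ℝ →ₗ[ℝ] V := LinearMap.coprod T (LinearMap.toSpanSingleton ℝ V η)
  have hS : ∀ e t, S (e, t) = T e + t • η := fun e t => by simp [S]
  have hbS : ∀ e t, b (T e + t • η) η = t := fun e t => by simp [hb (T e), h0, h1]
  have hinj : Function.Injective S := by
    rw [injective_iff_map_eq_zero]
    rintro ⟨e, t⟩ h
    rw [hS] at h
    have ht : t = 0 := by simpa [h] using (hbS e t).symm
    rw [ht, zero_smul, add_zero] at h
    rw [Prod.mk_eq_zero]
    exact ⟨hT (by simpa using h), ht⟩
  have hsurj : Function.Surjective S :=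
    (LinearMap.injective_iff_surjective_of_finrank_eq_finrank (by simp [hdim])).1 hinj
  obtain ⟨⟨e, t⟩, rfl⟩ := hsurj ξ
  exact ⟨e, by rw [hS, hbS]⟩

/-- The pull-back `F^* G` of a field of bilinear forms. -/
noncomputable def pullbackForm (G : V → V →L[ℝ] V →L[ℝ] ℝ) (F : E → V) (y : E) : E →L[ℝ] E →L[ℝ] ℝ :=
  (G (F y)).bilinearComp (fderiv ℝ F y) (fderiv ℝ F y)

theorem pullbackForm_apply (G : V → V →L[ℝ] V →L[ℝ] ℝ) (F : E → V) (y u v : E) :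
    pullbackForm G F y u v = G (F y) (fderiv ℝ F y u) (fderiv ℝ F y v) := rfl

/-- The ambient derivative `∇_u (DF v) = D²F(u, v) + Γ(DF u, DF v)` along the map `F`. -/
noncomputable def secondDeriv (G : V → V →L[ℝ] V →L[ℝ] ℝ) (F : E → V) (y : E) : E →L[ℝ] E →L[ℝ] V :=
  fderiv ℝ (fderiv ℝ F) y +
    (christoffel G (F y)).bilinearComp (fderiv ℝ F y) (fderiv ℝ F y)

theorem secondDeriv_apply (G : V → V →L[ℝ] V →L[ℝ] ℝ) (F : E → V) (y u v : E) :
    secondDeriv G F y u v =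
      fderiv ℝ (fderiv ℝ F) y u v + christoffel G (F y) (fderiv ℝ F y u) (fderiv ℝ F y v) := rfl

theorem _root_.ContDiffAt.clm_bilinearComp {X W : Type*} [NormedAddCommGroup X] [NormedSpace ℝ X]
    [NormedAddCommGroup W] [NormedSpace ℝ W] {n : WithTop ℕ∞} {B : X → V →L[ℝ] V →L[ℝ] W}
    {A : X → E →L[ℝ] V} {x : X} (hB : ContDiffAt ℝ n B x) (hA : ContDiffAt ℝ n A x) :
    ContDiffAt ℝ n (fun z => (B z).bilinearComp (A z) (A z)) x := by
  have h1 := (ContinuousLinearMap.flipₗᵢ ℝ E V W).contDiff.contDiffAt.comp x (hB.clm_comp hA)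
  exact (ContinuousLinearMap.flipₗᵢ ℝ E E W).contDiff.contDiffAt.comp x (h1.clm_comp hA)

variable {G : V → V →L[ℝ] V →L[ℝ] ℝ} {F : E → V} {y : E}

theorem IsMetricAt.pullback (hG : IsMetricAt G (F y)) (hF : ContDiffAt ℝ 3 F y)
    (hinj : ∀ᶠ z in 𝓝 y, Function.Injective (fderiv ℝ F z)) : IsMetricAt (pullbackForm G F) y where
  contDiffAt := (hG.contDiffAt.comp y (hF.of_le (by norm_num))).clm_bilinearComp
    (hF.fderiv_right (by norm_num))
  symm := by
    filter_upwards [hF.continuousAt.eventually hG.symm] with z hz u v using hz _ _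
  pos := by
    filter_upwards [hF.continuousAt.eventually hG.pos, hinj] with z hz hi u hu
    exact hz _ fun h => hu (hi (by simpa using h))

theorem fderiv_fderiv_apply {F : E → V} (hF : ContDiffAt ℝ 2 F y) (u v : E) :
    fderiv ℝ (fun z => fderiv ℝ F z v) y u = fderiv ℝ (fderiv ℝ F) y u v := by
  have hd : DifferentiableAt ℝ (fderiv ℝ F) y :=
    (hF.fderiv_right (m := 1) (by norm_num)).differentiableAt (by norm_num)
  rw [fderiv_clm_apply hd (differentiableAt_const _)]
  simp

variable [FiniteDimensional ℝ V]

theorem secondDeriv_symm (hG : IsMetricAt G (F y)) (hF : ContDiffAt ℝ 2 F y) (u v : E) :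
    secondDeriv G F y u v = secondDeriv G F y v u := by
  rw [secondDeriv_apply, secondDeriv_apply, hG.christoffel_symm, fderiv_fderiv_symm hF]

theorem fderiv_metric_comp (hG : IsMetricAt G (F y)) (hF : ContDiffAt ℝ 1 F y) {α β : E → V}
    (hα : DifferentiableAt ℝ α y) (hβ : DifferentiableAt ℝ β y) (u : E) :
    fderiv ℝ (fun z => G (F z) (α z) (β z)) y u =
      G (F y) (fderiv ℝ α y u + christoffel G (F y) (fderiv ℝ F y u) (α y)) (β y) +
      G (F y) (α y) (fderiv ℝ β y u + christoffel G (F y) (fderiv ℝ F y u) (β y)) := by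
  have hF' : DifferentiableAt ℝ F y := hF.differentiableAt (by norm_num)
  rw [fderiv_bilin_apply (B := fun z => G (F z)) (hG.differentiableAt.comp y hF') hα hβ,
    fderiv_fun_comp y hG.differentiableAt hF']
  simp only [ContinuousLinearMap.comp_apply, hG.fderiv_eq, map_add, add_apply]
  ring

theorem fderiv_secondDeriv_apply (hG : IsMetricAt G (F y)) (hF : ContDiffAt ℝ 3 F y) (u v w : E) :
    DifferentiableAt ℝ (fun z => secondDeriv G F z v w) y ∧
    fderiv ℝ (fun z => secondDeriv G F z v w) y u =
      fderiv ℝ (fderiv ℝ (fderiv ℝ F)) y u v w +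
      (fderiv ℝ (christoffel G) (F y) (fderiv ℝ F y u) (fderiv ℝ F y v) (fderiv ℝ F y w) +
        christoffel G (F y) (fderiv ℝ (fderiv ℝ F) y u v) (fderiv ℝ F y w) +
        christoffel G (F y) (fderiv ℝ F y v) (fderiv ℝ (fderiv ℝ F) y u w)) := by
  have hF2 : ContDiffAt ℝ 2 F y := hF.of_le (by norm_num)
  have hF' : DifferentiableAt ℝ F y := hF.differentiableAt (by norm_num)
  have hd : DifferentiableAt ℝ (fderiv ℝ F) y :=
    (hF2.fderiv_right (m := 1) (by norm_num)).differentiableAt (by norm_num)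
  have hdd : ContDiffAt ℝ 2 (fderiv ℝ F) y := hF.fderiv_right (by norm_num)
  have hdd' : DifferentiableAt ℝ (fderiv ℝ (fderiv ℝ F)) y :=
    (hdd.fderiv_right (m := 1) (by norm_num)).differentiableAt (by norm_num)
  have hΓ := hG.differentiableAt_christoffel
  have hΓF : DifferentiableAt ℝ (fun z => christoffel G (F z)) y := hΓ.comp y hF'
  simp only [secondDeriv_apply]
  refine ⟨by fun_prop, ?_⟩
  rw [fderiv_fun_add (by fun_prop) (by fun_prop), add_apply,
    fderiv_bilin_apply hdd' (by fun_prop) (by fun_prop),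
    fderiv_bilin_apply hΓF (by fun_prop) (by fun_prop), fderiv_fderiv_apply hF2,
    fderiv_fderiv_apply hF2, fderiv_fun_comp y hΓ hF']
  simp

variable [FiniteDimensional ℝ E]

/-- The tangential part of `∇_u (DF v)` is the Levi-Civita derivative of the induced metric. -/
theorem apply_secondDeriv (hG : IsMetricAt G (F y)) (hF : ContDiffAt ℝ 3 F y)
    (hinj : ∀ᶠ z in 𝓝 y, Function.Injective (fderiv ℝ F z)) (u v w : E) :
    G (F y) (secondDeriv G F y u v) (fderiv ℝ F y w) =
      pullbackForm G F y (christoffel (pullbackForm G F) y u v) w := by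
  have hg := hG.pullback hF hinj
  have hF2 : ContDiffAt ℝ 2 F y := hF.of_le (by norm_num)
  have hF1 : ContDiffAt ℝ 1 F y := hF.of_le (by norm_num)
  have hd : DifferentiableAt ℝ (fderiv ℝ F) y :=
    (hF2.fderiv_right (m := 1) (by norm_num)).differentiableAt (by norm_num)
  have key : ∀ a u v, fderiv ℝ (pullbackForm G F) y a u v =
      G (F y) (secondDeriv G F y a u) (fderiv ℝ F y v) +
      G (F y) (secondDeriv G F y a v) (fderiv ℝ F y u) := fun a u v => by
    have h1 : fderiv ℝ (fun z => pullbackForm G F z u v) y a =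
        fderiv ℝ (pullbackForm G F) y a u v :=
      fderiv_bilin_const_apply hg.differentiableAt u v a
    rw [← h1]
    simp only [pullbackForm_apply]
    rw [fderiv_metric_comp hG hF1 (by fun_prop) (by fun_prop), fderiv_fderiv_apply hF2,
      fderiv_fderiv_apply hF2, ← secondDeriv_apply, ← secondDeriv_apply,
      hG.symm_apply (fderiv ℝ F y u)]
  rw [hg.apply_christoffel, christoffelLower_apply, key, key, key, secondDeriv_symm hG hF2 v u,
    secondDeriv_symm hG hF2 w u, secondDeriv_symm hG hF2 w v]
  ring

/-- The Gauss equation of a hypersurface with unit normal `η`. It comes from differentiating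
`apply_secondDeriv` along `u` and skew-symmetrising in `u`, `v`, whereby the third derivatives of
`F` cancel. -/
theorem gauss_equation (hdim : Module.finrank ℝ V = Module.finrank ℝ E + 1)
    (hG : IsMetricAt G (F y)) (hF : ContDiffAt ℝ 3 F y)
    (hinj : ∀ᶠ z in 𝓝 y, Function.Injective (fderiv ℝ F z)) {η : V} (h1 : G (F y) η η = 1)
    (h0 : ∀ v, G (F y) η (fderiv ℝ F y v) = 0) (u v w x : E) :
    pullbackForm G F y (coordCurvature (pullbackForm G F) y v w u) x =
      G (F y) (coordCurvature G (F y) (fderiv ℝ F y v) (fderiv ℝ F y w) (fderiv ℝ F y u))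
        (fderiv ℝ F y x) +
      G (F y) η (secondDeriv G F y v w) * G (F y) η (secondDeriv G F y u x) -
      G (F y) η (secondDeriv G F y u w) * G (F y) η (secondDeriv G F y v x) := by
  have hg := hG.pullback hF hinj
  have hF2 : ContDiffAt ℝ 2 F y := hF.of_le (by norm_num)
  have hF1 : ContDiffAt ℝ 1 F y := hF.of_le (by norm_num)
  have hd : DifferentiableAt ℝ (fderiv ℝ F) y :=
    (hF2.fderiv_right (m := 1) (by norm_num)).differentiableAt (by norm_num)
  have hdd : ContDiffAt ℝ 2 (fderiv ℝ F) y := hF.fderiv_right (by norm_num)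
  have hΓ := hg.differentiableAt_christoffel
  -- the derivative along `u` of `⟨∇_v (DF w), DF x⟩ = g(∇_v w, x)`
  have key : ∀ u v,
      G (F y) (fderiv ℝ (fun z => secondDeriv G F z v w) y u +
        christoffel G (F y) (fderiv ℝ F y u) (secondDeriv G F y v w)) (fderiv ℝ F y x) +
      G (F y) (secondDeriv G F y v w) (secondDeriv G F y u x) =
      pullbackForm G F y (fderiv ℝ (christoffel (pullbackForm G F)) y u v w +
        christoffel (pullbackForm G F) y u (christoffel (pullbackForm G F) y v w)) x +
      pullbackForm G F y (christoffel (pullbackForm G F) y v w)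
        (christoffel (pullbackForm G F) y u x) := fun u v => by
    have hev : (fun z => G (F z) (secondDeriv G F z v w) (fderiv ℝ F z x)) =ᶠ[𝓝 y]
        fun z => pullbackForm G F z (christoffel (pullbackForm G F) z v w) x := by
      filter_upwards [hF.continuousAt.eventually hG.eventually, hF.eventually (by decide),
        hinj.eventually_nhds] with z h1 h2 h3
      exact apply_secondDeriv h1 h2 h3 v w x
    have e := DFunLike.congr_fun (hev.fderiv_eq (𝕜 := ℝ)) u
    have hΓv : DifferentiableAt ℝ (fun z => christoffel (pullbackForm G F) z v w) y := by fun_prop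
    rw [fderiv_metric_comp hG hF1 (fderiv_secondDeriv_apply hG hF u v w).1 (by fun_prop),
      fderiv_bilin_apply hg.differentiableAt hΓv (differentiableAt_const _),
      fderiv_bilin_const_apply hΓ, hg.fderiv_eq,
      fderiv_fderiv_apply hF2, ← secondDeriv_apply] at e
    rw [e]
    simp only [map_add, add_apply, fderiv_fun_const, Pi.zero_apply, zero_apply, map_zero]
    ring
  have hΓB : ∀ a b c, christoffel G (F y) a (secondDeriv G F y b c) =
      christoffel G (F y) a (fderiv ℝ (fderiv ℝ F) y b c) +
        christoffel G (F y) a (christoffel G (F y) (fderiv ℝ F y b) (fderiv ℝ F y c)) :=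
    fun a b c => by rw [secondDeriv_apply, map_add]
  have kuv := key u v
  have kvu := key v u
  rw [(fderiv_secondDeriv_apply hG hF _ _ _).2, hΓB] at kuv
  rw [(fderiv_secondDeriv_apply hG hF _ _ _).2, hΓB] at kvu
  -- the Gauss formula: tangential and normal parts of `∇_a (DF b)`
  have formula : ∀ a b, secondDeriv G F y a b =
      fderiv ℝ F y (christoffel (pullbackForm G F) y a b) +
        G (F y) η (secondDeriv G F y a b) • η := fun a b => by
    obtain ⟨e, he⟩ := exists_eq_tangent_add_normal hdim hG.symm_apply hinj.self_of_nhds h1 h0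
      (secondDeriv G F y a b)
    have : e = christoffel (pullbackForm G F) y a b := hg.ext_left fun z => by
      rw [← apply_secondDeriv hG hF hinj, he, pullbackForm_apply]
      simp [h0]
    rw [← this, hG.symm_apply η]
    exact he
  have hh : ∀ a b a' b', G (F y) (secondDeriv G F y a b) (secondDeriv G F y a' b') =
      pullbackForm G F y (christoffel (pullbackForm G F) y a b)
        (christoffel (pullbackForm G F) y a' b') +
      G (F y) η (secondDeriv G F y a b) * G (F y) η (secondDeriv G F y a' b') :=
    fun a b a' b' => by
      rw [formula a b, formula a' b', pullbackForm_apply]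
      simp [h0, h1, hG.symm_apply _ η]
  rw [hh] at kuv kvu
  rw [coordCurvature_apply, coordCurvature_apply]
  simp only [map_add, map_sub, add_apply, sub_apply] at kuv kvu ⊢
  rw [fderiv_fderiv_symm hdd v u, fderiv_fderiv_symm hF2 v u] at kvu
  linarith

end Gauss

end RealHypersurface

/-! ### Orthonormal bases and the trace of the Gauss equation -/

namespace RealHypersurface

section OrthonormalBasis

variable {E : Type*} [AddCommGroup E] [Module ℝ E] {b : E →ₗ[ℝ] E →ₗ[ℝ] ℝ}

/-- A vector of norm one is the last vector of an orthonormal basis. -/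
theorem exists_orthonormal_basis [FiniteDimensional ℝ E] (hb : ∀ u v, b u v = b v u)
    (hpos : ∀ u, u ≠ 0 → 0 < b u u) {m : ℕ} (hm : Module.finrank ℝ E = m + 1) {X : E}
    (hX : b X X = 1) : ∃ e : Module.Basis (Fin m ⊕ Fin 1) ℝ E,
      (∀ i j, b (e i) (e j) = if i = j then 1 else 0) ∧ e (Sum.inr 0) = X := by
  let core : InnerProductSpace.Core ℝ E :=
    { inner := fun u v => b u v
      conj_inner_symm := fun u v => by simp [hb v u]
      re_inner_nonneg := fun u => by
        by_cases hu : u = 0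
        · simp [hu]
        · exact (hpos u hu).le
      add_left := fun u v w => by simp
      smul_left := fun u v r => by simp
      definite := fun u hu => by
        by_contra h
        exact (hpos u h).ne' hu }
  let _ : NormedAddCommGroup E := core.toNormedAddCommGroup
  let _ : InnerProductSpace ℝ E := InnerProductSpace.ofCore core.toCore
  have hinner : ∀ u v, inner ℝ u v = b u v := fun u v => rfl
  have ho : Orthonormal ℝ (({Sum.inr 0} : Set (Fin m ⊕ Fin 1)).domRestrict fun _ => X) := by
    rw [orthonormal_iff_ite]
    intro i j
    rw [if_pos (Subsingleton.elim i j)]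
    exact hX
  obtain ⟨e, he⟩ := ho.exists_orthonormalBasis_extension_of_card_eq (by simp [hm])
  refine ⟨e.toBasis, fun i j => ?_, by simpa using he (Sum.inr 0) rfl⟩
  have := orthonormal_iff_ite.1 e.orthonormal i j
  rw [hinner] at this
  simpa using this

variable {ι : Type*} [Fintype ι] [DecidableEq ι] {e : Module.Basis ι ℝ E}

theorem repr_orthonormal (he : ∀ i j, b (e i) (e j) = if i = j then 1 else 0) (u : E) (i : ι) :
    e.repr u i = b u (e i) := by
  conv_rhs => rw [← e.sum_repr u]
  simp only [map_sum, map_smul, LinearMap.sum_apply, LinearMap.smul_apply, he]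
  simp

theorem parseval (he : ∀ i j, b (e i) (e j) = if i = j then 1 else 0) (u v : E) :
    b u v = ∑ i, b u (e i) * b v (e i) := by
  conv_lhs => rw [← e.sum_repr v]
  simp [repr_orthonormal he, mul_comm]

theorem toMatrix_orthonormal (he : ∀ i j, b (e i) (e j) = if i = j then 1 else 0)
    (L : E →ₗ[ℝ] E) (i j : ι) : LinearMap.toMatrix e e L i j = b (L (e j)) (e i) := by
  rw [LinearMap.toMatrix_apply, repr_orthonormal he]

theorem trace_orthonormal (he : ∀ i j, b (e i) (e j) = if i = j then 1 else 0)
    (L : E →ₗ[ℝ] E) : LinearMap.trace ℝ E L = ∑ i, b (L (e i)) (e i) := by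
  rw [LinearMap.trace_eq_matrix_trace ℝ e, Matrix.trace]
  simp [toMatrix_orthonormal he]

/-- With `κ = ⟨AX, X⟩` and `T = Tr A`, the difference of the two sides is
`2 (κ - T / 4)² + |AX - κ X|²`. So equality means `AX = κ X` and `T = 4 κ`. -/
theorem ricci_inequality [FiniteDimensional ℝ E] (hb : ∀ u v, b u v = b v u)
    (hpos : ∀ u, u ≠ 0 → 0 < b u u) {m : ℕ} (hm : Module.finrank ℝ E = m + 1) {X : E}
    (hX : b X X = 1) {A : E →ₗ[ℝ] E} (hA : ∀ u v, b (A u) v = b (A v) u) :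
    b (A X) X * LinearMap.trace ℝ E A - b (A X) (A X) ≤
        LinearMap.trace ℝ E A ^ 2 / 8 + b (A X) X ^ 2 ∧
    (b (A X) X * LinearMap.trace ℝ E A - b (A X) (A X) =
        LinearMap.trace ℝ E A ^ 2 / 8 + b (A X) X ^ 2 ↔
      ∃ (e : Module.Basis (Fin m ⊕ Fin 1) ℝ E) (B : Matrix (Fin m) (Fin m) ℝ) (μ : ℝ),
        (∀ i j, b (e i) (e j) = if i = j then 1 else 0) ∧ e (Sum.inr 0) = X ∧
        LinearMap.toMatrix e e A = Matrix.fromBlocks B 0 0 (Matrix.of fun _ _ => μ) ∧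
        B.IsSymm ∧ B.trace = 3 * μ) := by
  set κ := b (A X) X with hκ
  set T := LinearMap.trace ℝ E A
  have hnonneg : ∀ u, 0 ≤ b u u := fun u => by
    by_cases hu : u = 0
    · simp [hu]
    · exact (hpos u hu).le
  have hsq : b (A X - κ • X) (A X - κ • X) = b (A X) (A X) - κ ^ 2 := by
    simp [hX, hb X (A X), ← hκ]
    ring
  have hdiff : T ^ 2 / 8 + κ ^ 2 - (κ * T - b (A X) (A X)) =
      2 * (κ - T / 4) ^ 2 + b (A X - κ • X) (A X - κ • X) := by
    rw [hsq]; ring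
  have h1 := hnonneg (A X - κ • X)
  have h2 := sq_nonneg (κ - T / 4)
  refine ⟨by linarith, fun heq => ?_, ?_⟩
  · have hTκ : T = 4 * κ := by
      have : (κ - T / 4) ^ 2 = 0 := by linarith
      have := pow_eq_zero_iff (two_ne_zero) |>.1 this
      linarith
    have hAX : A X = κ • X := by
      by_contra h
      have := hpos _ (sub_ne_zero.2 h)
      linarith
    obtain ⟨e, he, heX⟩ := exists_orthonormal_basis hb hpos hm hX
    have hbl : LinearMap.toMatrix e e A = Matrix.fromBlocks
        (LinearMap.toMatrix e e A).toBlocks₁₁ 0 0 (Matrix.of fun _ _ => κ) := by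
      ext (i | i) (j | j)
      · rfl
      · have hj : e (Sum.inr j) = X := by rw [Subsingleton.elim j 0, heX]
        rw [toMatrix_orthonormal he, hj, hAX, ← heX]
        simp [he]
      · have hi : e (Sum.inr i) = X := by rw [Subsingleton.elim i 0, heX]
        rw [toMatrix_orthonormal he, hA, hi, hAX, ← heX]
        simp [he]
      · have hi : e (Sum.inr i) = X := by rw [Subsingleton.elim i 0, heX]
        have hj : e (Sum.inr j) = X := by rw [Subsingleton.elim j 0, heX]
        rw [toMatrix_orthonormal he, hj, hi]
        rfl
    refine ⟨e, _, κ, he, heX, hbl, ?_, ?_⟩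
    · ext i j
      simp only [Matrix.transpose_apply, Matrix.toBlocks₁₁, Matrix.of_apply,
        toMatrix_orthonormal he]
      exact hA _ _
    · have ht : T = Matrix.trace (LinearMap.toMatrix e e A) :=
        LinearMap.trace_eq_matrix_trace ℝ e A
      rw [hbl] at ht
      simp [Matrix.trace] at ht ⊢
      linarith
  · rintro ⟨e, B, μ, he, heX, hbl, -, hB⟩
    have hAX : A X = μ • X := by
      apply e.repr.injective
      ext i
      have := congrFun (congrFun hbl i) (Sum.inr 0)
      rw [LinearMap.toMatrix_apply, heX] at this
      rw [this, map_smul, ← heX]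
      rcases i with i | i
      · simp
      · simp [Subsingleton.elim i 0]
    have hκμ : κ = μ := by rw [hκ, hAX]; simp [hX]
    have ht : T = 4 * μ := by
      have ht : T = Matrix.trace (LinearMap.toMatrix e e A) :=
        LinearMap.trace_eq_matrix_trace ℝ e A
      rw [hbl] at ht
      simp [Matrix.trace] at ht hB
      linarith
    rw [ht, hκμ, hAX]
    simp [hX]
    ring

end OrthonormalBasis

section RicciTrace

variable {E : Type*} [NormedAddCommGroup E] [NormedSpace ℝ E] [FiniteDimensional ℝ E]
  {V : Type*} [NormedAddCommGroup V] [NormedSpace ℂ V] [FiniteDimensional ℝ V]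

/-- The Ricci curvature of a real hypersurface: the trace of the Gauss equation. -/
theorem trace_coordCurvature_pullback {c : ℝ} {G : V → V →L[ℝ] V →L[ℝ] ℝ} {F : E → V} {y : E}
    (hdim : Module.finrank ℝ V = Module.finrank ℝ E + 1)
    (hG : IsMetricAt G (F y)) (hF : ContDiffAt ℝ 3 F y)
    (hinj : Function.Injective (fderiv ℝ F y))
    (hherm : ∀ u v, G (F y) (Complex.I • u) (Complex.I • v) = G (F y) u v)
    (hsec : ∀ u v, G (F y) (coordCurvature G (F y) v v u) u =
      c * (G (F y) u u * G (F y) v v - G (F y) u v ^ 2 + 3 * G (F y) (Complex.I • u) v ^ 2))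
    {η : V} (h1 : G (F y) η η = 1) (h0 : ∀ v, G (F y) η (fderiv ℝ F y v) = 0)
    {A : E →ₗ[ℝ] E} (hA : ∀ u v, pullbackForm G F y (A u) v = G (F y) η (secondDeriv G F y u v))
    {X φ : E} (hX : pullbackForm G F y X X = 1)
    (hφ : fderiv ℝ F y φ = Complex.I • fderiv ℝ F y X -
      G (F y) (Complex.I • fderiv ℝ F y X) η • η) :
    LinearMap.trace ℝ E (coordCurvature (pullbackForm G F) y X X) =
      pullbackForm G F y (A X) X * LinearMap.trace ℝ E A - pullbackForm G F y (A X) (A X) +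
      c * (Module.finrank ℝ E - 1 + 3 * pullbackForm G F y φ φ) := by
  have hinj' : ∀ᶠ z in nhds y, Function.Injective (fderiv ℝ F z) :=
    (hF.fderiv_right (m := 2) (by norm_num)).continuousAt.eventually
      (ContinuousLinearMap.isOpen_injective.mem_nhds hinj)
  have hg := hG.pullback hF hinj'
  have hF2 : ContDiffAt ℝ 2 F y := hF.of_le (by norm_num)
  let b : E →ₗ[ℝ] E →ₗ[ℝ] ℝ := (pullbackForm G F y).toLinearMap₁₂
  have hbg : ∀ u v, b u v = pullbackForm G F y u v := fun u v => rfl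
  have : Nontrivial E := ⟨X, 0, fun h => by simp [h] at hX⟩
  obtain ⟨m, hm⟩ := Nat.exists_eq_succ_of_ne_zero (Module.finrank_pos (R := ℝ) (M := E)).ne'
  obtain ⟨e, he, -⟩ := exists_orthonormal_basis (b := b) hg.symm_apply
    (fun u hu => hg.pos_apply hu) hm hX
  have hterm : ∀ i, b (coordCurvature (pullbackForm G F) y X X (e i)) (e i) =
      c * (b (e i) (e i) - b X (e i) * b X (e i) + 3 * (b φ (e i) * b φ (e i))) +
      (b (A X) X * b (A (e i)) (e i) - b (A X) (e i) * b (A X) (e i)) := fun i => by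
    -- `J` is skew and `φX` differs from `JX` by a normal vector
    have hJ : G (F y) (Complex.I • fderiv ℝ F y (e i)) (fderiv ℝ F y X) = - b φ (e i) := by
      rw [hbg, pullbackForm_apply, hφ, ← hherm, smul_smul, Complex.I_mul_I, hG.symm_apply]
      simp [h0]
    simp only [hbg, hA, gauss_equation hdim hG hF hinj' h1 h0, hsec, hJ,
      secondDeriv_symm hG hF2 (e i) X, ← pullbackForm_apply, hX, hg.symm_apply (e i) X]
    ring
  -- `∑ᵢ ⟨JX, eᵢ⟩² = |φX|²` and `∑ᵢ ⟨AX, eᵢ⟩² = |AX|²`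
  rw [trace_orthonormal he, trace_orthonormal he, Finset.sum_congr rfl fun i _ => hterm i,
    Finset.sum_add_distrib, ← Finset.mul_sum, Finset.sum_add_distrib, Finset.sum_sub_distrib,
    Finset.sum_sub_distrib, ← Finset.mul_sum, ← Finset.mul_sum, ← parseval he, ← parseval he,
    ← parseval he, hbg X X, hX]
  simp only [hbg, hm]
  simp [← hbg, he]
  ring

end RicciTrace

end RealHypersurface

/-! ### Passing from manifolds to charts -/

namespace RealHypersurface

open Filter Topology

section Congruence

variable {E : Type*} [NormedAddCommGroup E] [NormedSpace ℝ E]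

theorem coordCurvature_congr {G G' : E → E →L[ℝ] E →L[ℝ] ℝ} {y : E} (h : G =ᶠ[𝓝 y] G') :
    coordCurvature G y = coordCurvature G' y := by
  have hΓ : christoffel G =ᶠ[𝓝 y] christoffel G' := by
    filter_upwards [h, h.fderiv (𝕜 := ℝ)] with z h1 h2
    simp only [christoffel, christoffelLower, h1, h2]
  funext v w
  ext u
  simp only [coordCurvature_apply, hΓ.fderiv_eq (𝕜 := ℝ), hΓ.eq_of_nhds]

end Congruence

section Charts

variable {E : Type*} [NormedAddCommGroup E] [NormedSpace ℝ E]
  {M : Type*} [TopologicalSpace M] [ChartedSpace E M]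

theorem metricInChart_apply (g : FormField E M) (q : M) (y u v : E) :
    metricInChart g q y u v = g ((extChartAt 𝓘(ℝ, E) q).symm y)
      (mfderiv 𝓘(ℝ, E) 𝓘(ℝ, E) (extChartAt 𝓘(ℝ, E) q).symm y u)
      (mfderiv 𝓘(ℝ, E) 𝓘(ℝ, E) (extChartAt 𝓘(ℝ, E) q).symm y v) := rfl

/-- A form field evaluated at equal points, on vectors with equal coordinates; the tangent spaces
at the two points are identified through the model space. -/
theorem formField_congr (g : FormField E M) {x x' : M} (h : x = x') {u u' v v' : E} (hu : u = u')
    (hv : v = v') :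
    DFunLike.coe (F := E →L[ℝ] ℝ) (DFunLike.coe (F := E →L[ℝ] E →L[ℝ] ℝ) (g x) u) v =
      DFunLike.coe (F := E →L[ℝ] ℝ) (DFunLike.coe (F := E →L[ℝ] E →L[ℝ] ℝ) (g x') u') v' := by
  subst h hu hv
  rfl

/-- At its base point, the preferred chart computes the metric itself. -/
theorem metricInChart_self [IsManifold 𝓘(ℝ, E) 1 M] (g : FormField E M) (q : M) (u v : E) :
    metricInChart g q (extChartAt 𝓘(ℝ, E) q q) u v =
      DFunLike.coe (F := E →L[ℝ] ℝ) (DFunLike.coe (F := E →L[ℝ] E →L[ℝ] ℝ) (g q) u) v := by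
  have h := mfderivWithin_range_extChartAt_symm (I := 𝓘(ℝ, E)) (x := q)
  rw [modelWithCornersSelf_coe, Set.range_id, mfderivWithin_univ] at h
  exact formField_congr g (extChartAt_to_inv q) (DFunLike.congr_fun h u) (DFunLike.congr_fun h v)

/-- The coordinate vector fields of a chart are smooth: in the trivialization of the tangent bundle
given by that chart they are constant. -/
theorem contMDiffOn_coordinateField [IsManifold 𝓘(ℝ, E) ∞ M] (q : M) (u : E) :
    ContMDiffOn 𝓘(ℝ, E) (𝓘(ℝ, E).prod 𝓘(ℝ, E)) ∞
      (fun y : E => (⟨(extChartAt 𝓘(ℝ, E) q).symm y,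
        mfderiv 𝓘(ℝ, E) 𝓘(ℝ, E) (extChartAt 𝓘(ℝ, E) q).symm y u⟩ : TangentBundle 𝓘(ℝ, E) M))
      (extChartAt 𝓘(ℝ, E) q).target := by
  have hbase : ∀ y ∈ (extChartAt 𝓘(ℝ, E) q).target,
      (extChartAt 𝓘(ℝ, E) q).symm y ∈ (chartAt E q).source := fun y hy => by
    simpa using (extChartAt 𝓘(ℝ, E) q).map_target hy
  refine (Bundle.Trivialization.contMDiffOn_iff
    (e := trivializationAt E (TangentSpace (M := M) 𝓘(ℝ, E)) q) fun y hy => ?_).2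
    ⟨contMDiffOn_extChartAt_symm q, (contMDiffOn_const (c := u)).congr fun y hy => ?_⟩
  · rw [Bundle.Trivialization.mem_source]
    exact hbase y hy
  · have h1 := mfderiv_extChartAt_comp_mfderivWithin_extChartAt_symm (I := 𝓘(ℝ, E)) hy
    rw [modelWithCornersSelf_coe, Set.range_id, mfderivWithin_univ] at h1
    have h2 := TangentBundle.continuousLinearMapAt_trivializationAt (I := 𝓘(ℝ, E)) (hbase y hy)
    have h3 := DFunLike.congr_fun h1 u
    rw [← h2] at h3
    exact (Bundle.Trivialization.continuousLinearMapAt_apply_of_mem ℝ _ (hbase y hy) _).symm.trans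
      h3

theorem contMDiffOn_metricInChart_apply [IsManifold 𝓘(ℝ, E) ∞ M]
    (g : Bundle.ContMDiffRiemannianMetric 𝓘(ℝ, E) ∞ E (fun x : M => TangentSpace 𝓘(ℝ, E) x))
    (q : M) (u v : E) :
    ContMDiffOn 𝓘(ℝ, E) 𝓘(ℝ, ℝ) ∞ (fun y => metricInChart g.inner q y u v)
      (extChartAt 𝓘(ℝ, E) q).target := fun y hy => by
  have h1 := (g.contMDiff ((extChartAt 𝓘(ℝ, E) q).symm y)).comp_contMDiffWithinAt y
    (contMDiffOn_extChartAt_symm (n := ∞) q y hy)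
  have h2 := ContMDiffWithinAt.clm_bundle_apply₂ (F₁ := E) (F₂ := E) (F₃ := ℝ)
    (E₁ := fun x : M => TangentSpace 𝓘(ℝ, E) x) (E₂ := fun x : M => TangentSpace 𝓘(ℝ, E) x)
    (E₃ := Bundle.Trivial M ℝ) (b := (extChartAt 𝓘(ℝ, E) q).symm)
    (ψ := fun y => g.inner ((extChartAt 𝓘(ℝ, E) q).symm y)) h1
    (contMDiffOn_coordinateField q u y hy) (contMDiffOn_coordinateField q v y hy)
  rw [Bundle.contMDiffWithinAt_totalSpace] at h2
  exact h2.2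

theorem isMetricAt_metricInChart [FiniteDimensional ℝ E] [IsManifold 𝓘(ℝ, E) ∞ M]
    (g : Bundle.ContMDiffRiemannianMetric 𝓘(ℝ, E) ∞ E (fun x : M => TangentSpace 𝓘(ℝ, E) x))
    (q : M) : IsMetricAt (metricInChart g.inner q) (extChartAt 𝓘(ℝ, E) q q) where
  contDiffAt := by
    have hon : ContDiffOn ℝ ∞ (metricInChart g.inner q) (extChartAt 𝓘(ℝ, E) q).target :=
      contDiffOn_clm_apply.2 fun u => contDiffOn_clm_apply.2 fun v => fun y hy =>
        contMDiffWithinAt_iff_contDiffWithinAt.1 (contMDiffOn_metricInChart_apply g q u v y hy)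
    exact (hon.contDiffAt (extChartAt_target_mem_nhds q)).of_le
      ENat.LEInfty.out
  symm := Eventually.of_forall fun y u v => by
    rw [metricInChart_apply, metricInChart_apply]
    exact g.symm ((extChartAt 𝓘(ℝ, E) q).symm y) _ _
  pos := by
    filter_upwards [extChartAt_target_mem_nhds q] with y hy u hu
    rw [metricInChart_apply]
    refine g.pos ((extChartAt 𝓘(ℝ, E) q).symm y) _ fun h => hu ?_
    have hi := (isInvertible_mfderivWithin_extChartAt_symm (I := 𝓘(ℝ, E)) hy).injective
    rw [modelWithCornersSelf_coe, Set.range_id, mfderivWithin_univ] at hi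
    exact hi (h.trans (map_zero _).symm)

end Charts

section Hypersurface

variable {E : Type*} [NormedAddCommGroup E] [NormedSpace ℝ E]
  {M : Type*} [TopologicalSpace M] [ChartedSpace E M]
  {V : Type*} [NormedAddCommGroup V] [NormedSpace ℝ V]
  {N : Type*} [TopologicalSpace N] [ChartedSpace V N]
  {f : M → N}

theorem contDiffAt_writtenInExtChartAt (hf : ContMDiff 𝓘(ℝ, E) 𝓘(ℝ, V) ∞ f) (p : M) :
    ContDiffAt ℝ ∞ (writtenInExtChartAt 𝓘(ℝ, E) 𝓘(ℝ, V) p f) (extChartAt 𝓘(ℝ, E) p p) := by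
  have h := (contMDiffAt_iff.1 (hf p)).2
  rwa [modelWithCornersSelf_coe, Set.range_id, contDiffWithinAt_univ] at h

theorem fderiv_writtenInExtChartAt (hf : ContMDiff 𝓘(ℝ, E) 𝓘(ℝ, V) ∞ f) (p : M) :
    fderiv ℝ (writtenInExtChartAt 𝓘(ℝ, E) 𝓘(ℝ, V) p f) (extChartAt 𝓘(ℝ, E) p p) =
      mfderiv 𝓘(ℝ, E) 𝓘(ℝ, V) f p := by
  have h := ((hf p).mdifferentiableAt (by simp)).mfderiv
  rw [h, modelWithCornersSelf_coe, Set.range_id, fderivWithin_univ]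

theorem writtenInExtChartAt_self (p : M) :
    writtenInExtChartAt 𝓘(ℝ, E) 𝓘(ℝ, V) p f (extChartAt 𝓘(ℝ, E) p p) =
      extChartAt 𝓘(ℝ, V) (f p) (f p) := by
  simp [writtenInExtChartAt]

variable [IsManifold 𝓘(ℝ, E) ∞ M] [IsManifold 𝓘(ℝ, V) ∞ N]

/-- In charts, the induced metric is the pull-back of the ambient metric. -/
theorem metricInChart_inducedMetric (g : FormField V N) (hf : ContMDiff 𝓘(ℝ, E) 𝓘(ℝ, V) ∞ f)
    (p : M) :
    metricInChart (inducedMetric (E := E) g f) p =ᶠ[𝓝 (extChartAt 𝓘(ℝ, E) p p)]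
      pullbackForm (metricInChart g (f p)) (writtenInExtChartAt 𝓘(ℝ, E) 𝓘(ℝ, V) p f) := by
  set F := writtenInExtChartAt 𝓘(ℝ, E) 𝓘(ℝ, V) p f
  have hF3 : ContDiffAt ℝ 3 F (extChartAt 𝓘(ℝ, E) p p) :=
    (contDiffAt_writtenInExtChartAt hf p).of_le ENat.LEInfty.out
  have hsymm : ContinuousAt (extChartAt 𝓘(ℝ, E) p).symm (extChartAt 𝓘(ℝ, E) p p) :=
    continuousAt_extChartAt_symm p
  have hcont : ContinuousAt (fun y => f ((extChartAt 𝓘(ℝ, E) p).symm y))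
      (extChartAt 𝓘(ℝ, E) p p) :=
    hf.continuous.continuousAt.comp hsymm
  have hsrc : ∀ᶠ y in 𝓝 (extChartAt 𝓘(ℝ, E) p p),
      f ((extChartAt 𝓘(ℝ, E) p).symm y) ∈ (extChartAt 𝓘(ℝ, V) (f p)).source :=
    hcont.eventually (by
      simp only [extChartAt_to_inv]
      exact extChartAt_source_mem_nhds (f p))
  filter_upwards [hF3.eventually (by decide), hsrc.eventually_nhds,
    extChartAt_target_mem_nhds p] with y hFy hs hy
  have hs' := hs.self_of_nhds
  have hFy' : F y ∈ (extChartAt 𝓘(ℝ, V) (f p)).target := (extChartAt 𝓘(ℝ, V) (f p)).map_source hs'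
  have hinv : (extChartAt 𝓘(ℝ, V) (f p)).symm (F y) = f ((extChartAt 𝓘(ℝ, E) p).symm y) :=
    (extChartAt 𝓘(ℝ, V) (f p)).left_inv hs'
  have d1 : MDifferentiableAt 𝓘(ℝ, E) 𝓘(ℝ, E) (extChartAt 𝓘(ℝ, E) p).symm y := by
    have := mdifferentiableWithinAt_extChartAt_symm (I := 𝓘(ℝ, E)) hy
    rwa [modelWithCornersSelf_coe, Set.range_id, mdifferentiableWithinAt_univ] at this
  have d2 : MDifferentiableAt 𝓘(ℝ, V) 𝓘(ℝ, V) (extChartAt 𝓘(ℝ, V) (f p)).symm (F y) := by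
    have := mdifferentiableWithinAt_extChartAt_symm (I := 𝓘(ℝ, V)) hFy'
    rwa [modelWithCornersSelf_coe, Set.range_id, mdifferentiableWithinAt_univ] at this
  have d3 : HasMFDerivAt 𝓘(ℝ, E) 𝓘(ℝ, V) F y (fderiv ℝ F y) :=
    (hFy.differentiableAt (by norm_num)).hasFDerivAt.hasMFDerivAt
  have d4 := ((hf ((extChartAt 𝓘(ℝ, E) p).symm y)).mdifferentiableAt (by simp)).hasMFDerivAt
  have c1 := d2.hasMFDerivAt.comp y d3
  have c2 := d4.comp y d1.hasMFDerivAt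
  have hev : f ∘ (extChartAt 𝓘(ℝ, E) p).symm =ᶠ[𝓝 y] (extChartAt 𝓘(ℝ, V) (f p)).symm ∘ F := by
    filter_upwards [hs] with z hz
    exact ((extChartAt 𝓘(ℝ, V) (f p)).left_inv hz).symm
  have c := hasMFDerivAt_unique (c1.congr_of_eventuallyEq hev) c2
  ext u v
  exact (formField_congr g hinv (DFunLike.congr_fun c u) (DFunLike.congr_fun c v)).symm

end Hypersurface

end RealHypersurface

/-! ### The Ricci curvature inequality -/

theorem lemma2p2 {n : ℕ} {c : ℝ} (hc : c ≠ 0)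
    -- the ambient complex space form `N` of complex dimension `n` with its metric `g`
    {V : Type*} [NormedAddCommGroup V] [NormedSpace ℂ V] [FiniteDimensional ℂ V]
    (hV : Module.finrank ℂ V = n)
    {N : Type*} [TopologicalSpace N] [ChartedSpace V N]
    [IsManifold 𝓘(ℂ, V) ∞ N] [IsManifold 𝓘(ℝ, V) ∞ N]
    (g : Bundle.ContMDiffRiemannianMetric 𝓘(ℝ, V) ∞ V (fun x : N => TangentSpace 𝓘(ℝ, V) x))
    (hg : IsComplexSpaceForm c g.inner)
    -- the immersed real hypersurface `f : M → N`
    {E : Type*} [NormedAddCommGroup E] [NormedSpace ℝ E] [FiniteDimensional ℝ E]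
    (hE : Module.finrank ℝ E + 1 = 2 * n)
    {M : Type*} [TopologicalSpace M] [ChartedSpace E M] [IsManifold 𝓘(ℝ, E) ∞ M]
    (f : M → N) (hf : ContMDiff 𝓘(ℝ, E) 𝓘(ℝ, V) ∞ f)
    (hf' : ∀ q : M, Function.Injective (mfderiv 𝓘(ℝ, E) 𝓘(ℝ, V) f q))
    -- a point, a unit normal vector and a unit tangent vector there
    (p : M) (η : TangentSpace 𝓘(ℝ, V) (f p)) (hη : IsUnitNormal (E := E) g.inner f p η)
    (X : TangentSpace 𝓘(ℝ, E) p) (hX : inducedMetric g.inner f p X X = 1) :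
    ricci (inducedMetric (E := E) g.inner f) p X ≤
        (2 * (n : ℝ) - 1) ^ 2 / 8 *
            g.inner (f p) (meanCurvature (E := E) g.inner f p η)
              (meanCurvature (E := E) g.inner f p η)
          + normalCurvature g.inner f p η X ^ 2
          + c * (2 * (n : ℝ) - 2 +
              3 * g.inner (f p) (phi g.inner f p η X) (phi g.inner f p η X)) ∧
    (ricci (inducedMetric (E := E) g.inner f) p X =
        (2 * (n : ℝ) - 1) ^ 2 / 8 *
            g.inner (f p) (meanCurvature (E := E) g.inner f p η)
              (meanCurvature (E := E) g.inner f p η)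
          + normalCurvature g.inner f p η X ^ 2
          + c * (2 * (n : ℝ) - 2 +
              3 * g.inner (f p) (phi g.inner f p η X) (phi g.inner f p η X)) ↔
      ∃ (e : Module.Basis (Fin (2 * n - 2) ⊕ Fin 1) ℝ (TangentSpace 𝓘(ℝ, E) p))
        (B : Matrix (Fin (2 * n - 2)) (Fin (2 * n - 2)) ℝ) (μ : ℝ),
        (∀ i j, inducedMetric g.inner f p (e i) (e j) = if i = j then 1 else 0) ∧
        e (Sum.inr 0) = X ∧
        LinearMap.toMatrix e e (shapeOp g.inner f p η) =
          Matrix.fromBlocks B 0 0 (Matrix.of fun _ _ => μ) ∧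
        B.IsSymm ∧ B.trace = 3 * μ) := by
  set F : E → V := writtenInExtChartAt 𝓘(ℝ, E) 𝓘(ℝ, V) p f
  set y : E := extChartAt 𝓘(ℝ, E) p p
  set G : V → V →L[ℝ] V →L[ℝ] ℝ := metricInChart g.inner (f p)
  have hFy : F y = extChartAt 𝓘(ℝ, V) (f p) (f p) := writtenInExtChartAt_self p
  have hF : ContDiffAt ℝ 3 F y := (contDiffAt_writtenInExtChartAt hf p).of_le ENat.LEInfty.out
  have hDF : fderiv ℝ F y = mfderiv 𝓘(ℝ, E) 𝓘(ℝ, V) f p := fderiv_writtenInExtChartAt hf p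
  have hinj : Function.Injective (fderiv ℝ F y) := by rw [hDF]; exact hf' p
  have hG : IsMetricAt G (F y) := by rw [hFy]; exact isMetricAt_metricInChart g (f p)
  -- the tensors at `f p` and `p` in terms of the coefficient fields
  have hGg : ∀ u v : V, G (F y) u v = DFunLike.coe (F := V →L[ℝ] ℝ)
      (DFunLike.coe (F := V →L[ℝ] V →L[ℝ] ℝ) (g.inner (f p)) u) v := fun u v => by
    rw [hFy]; exact metricInChart_self _ _ u v
  have hind : ∀ u v : E, pullbackForm G F y u v = DFunLike.coe (F := E →L[ℝ] ℝ)
      (DFunLike.coe (F := E →L[ℝ] E →L[ℝ] ℝ) (inducedMetric g.inner f p) u) v := fun u v => by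
    rw [pullbackForm_apply, hGg, hDF]; rfl
  have hric : ricci (inducedMetric (E := E) g.inner f) p X =
      LinearMap.trace ℝ E (coordCurvature (pullbackForm G F) y X X) := by
    rw [ricci, coordCurvature_congr (metricInChart_inducedMetric g.inner hf p)]
  have hdimV : Module.finrank ℝ V = Module.finrank ℝ E + 1 := by
    rw [finrank_real_of_complex, hV, hE]
  have hherm : ∀ u v, G (F y) (Complex.I • u) (Complex.I • v) = G (F y) u v := fun u v => by
    rw [hGg, hGg]; exact hg.hermitian (f p) u v
  have hsec : ∀ u v, G (F y) (coordCurvature G (F y) v v u) u =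
      c * (G (F y) u u * G (F y) v v - G (F y) u v ^ 2 + 3 * G (F y) (Complex.I • u) v ^ 2) := by
    refine apply_coordCurvature_of_holomorphic hG ?_ hherm fun u => ?_
    · rw [hFy]
      filter_upwards [extChartAt_target_mem_nhds (I := 𝓘(ℝ, V)) (f p)] with z hz
      exact hg.parallel (f p) z hz
    · rw [hGg, hGg, hFy]
      exact hg.holSec (f p) u
  have h1 : G (F y) η η = 1 := (hGg η η).trans hη.1
  have h0 : ∀ v, G (F y) η (fderiv ℝ F y v) = 0 := fun v => by
    rw [hDF]; exact (hGg η _).trans (hη.2 v)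
  have hinj' : ∀ᶠ z in nhds y, Function.Injective (fderiv ℝ F z) :=
    (hF.fderiv_right (m := 2) (by norm_num)).continuousAt.eventually
      (ContinuousLinearMap.isOpen_injective.mem_nhds hinj)
  have hm := hG.pullback hF hinj'
  have hsd : ambientDeriv g.inner f p = secondDeriv G F y := by
    rw [ambientDeriv, secondDeriv, hFy]
  have hA : ∀ u v : E, pullbackForm G F y (shapeOp (E := E) g.inner f p η u) v =
      G (F y) η (secondDeriv G F y u v) := fun u v => by
    have hf : @Eq (E →L[ℝ] E →L[ℝ] ℝ) (pullbackForm G F y)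
        (inducedMetric (E := E) g.inner f p) := by
      ext u v; exact hind u v
    have hs : (shapeOp (E := E) g.inner f p η : E →ₗ[ℝ] E) u =
        (pullbackForm G F y).inverse (secondForm g.inner f p η u) := by
      rw [hf]; rfl
    refine (congrArg (fun t => pullbackForm G F y t v) hs).trans ?_
    rw [hm.isInvertible.self_apply_inverse]
    refine Eq.trans ?_ (hGg η (secondDeriv G F y u v)).symm
    rw [← hsd]
    rfl
  have hX' : pullbackForm G F y X X = 1 := (hind X X).trans hX
  obtain ⟨φ, hφ⟩ := exists_eq_tangent_add_normal hdimV hG.symm_apply hinj h1 h0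
    (HSMul.hSMul (β := V) (γ := V) Complex.I (fderiv ℝ F y X))
  replace hφ := (sub_eq_iff_eq_add.2 hφ).symm
  have key := trace_coordCurvature_pullback hdimV hG hF hinj hherm hsec h1 h0
    (A := (shapeOp (E := E) g.inner f p η : E →ₗ[ℝ] E)) hA hX' hφ
  -- the right-hand side of the inequality in terms of the coefficient fields
  have hn : (Module.finrank ℝ E : ℝ) = 2 * n - 1 := by
    have : (Module.finrank ℝ E : ℝ) + 1 = 2 * n := by exact_mod_cast hE
    linarith
  -- the mean curvature involves a division by `dim E`
  have hn0 : (2 * (n : ℝ) - 1) ≠ 0 := by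
    rw [← hn]
    have : Nontrivial E := ⟨X, 0, fun h => by simp [h] at hX'⟩
    exact_mod_cast (Module.finrank_pos (R := ℝ) (M := E)).ne'
  have hH : g.inner (f p) (meanCurvature (E := E) g.inner f p η)
      (meanCurvature (E := E) g.inner f p η) =
      (LinearMap.trace ℝ E (shapeOp (E := E) g.inner f p η) / (2 * n - 1)) ^ 2 := by
    rw [← hn, meanCurvature]
    simp only [map_smul, smul_apply, smul_eq_mul]
    rw [hη.1, mul_one, ← sq]
    rfl
  have hκ : normalCurvature (E := E) g.inner f p η X =
      pullbackForm G F y (shapeOp (E := E) g.inner f p η X) X := (hind _ _).symm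
  have hφφ : g.inner (f p) (phi (E := E) g.inner f p η X) (phi (E := E) g.inner f p η X) =
      pullbackForm G F y φ φ := by
    have hJX : HSMul.hSMul (β := V) (γ := V) Complex.I (fderiv ℝ F y X) =
        complexStr (mfderiv 𝓘(ℝ, E) 𝓘(ℝ, V) f p X) :=
      congrArg (fun L : E →L[ℝ] V => HSMul.hSMul (β := V) (γ := V) Complex.I (L X)) hDF
    have h : fderiv ℝ F y φ = phi (E := E) g.inner f p η X :=
      hφ.trans (congrArg₂ (fun (a : V) (t : ℝ) => HSub.hSub (β := V) a (t • η)) hJX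
        ((hGg _ η).trans (congrArg (fun a : V => g.inner (f p) a η) hJX)))
    rw [pullbackForm_apply, hGg, h]
    rfl
  have hdimE : Module.finrank ℝ E = (2 * n - 2) + 1 := by omega
  obtain ⟨hle, hiff⟩ := ricci_inequality (b := (pullbackForm G F y).toLinearMap₁₂) hm.symm_apply
    (fun u hu => hm.pos_apply hu) hdimE hX' (A := (shapeOp (E := E) g.inner f p η : E →ₗ[ℝ] E))
    (fun u v => by
      refine (hA u v).trans (Eq.trans ?_ (hA v u).symm)
      rw [secondDeriv_symm hG (hF.of_le (by norm_num))])
  set A : E →ₗ[ℝ] E := shapeOp (E := E) g.inner f p η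
  set T : ℝ := LinearMap.trace ℝ E A
  set K : ℝ := pullbackForm G F y (A X) X
  set S : ℝ := pullbackForm G F y (A X) (A X)
  replace hκ : normalCurvature (E := E) g.inner f p η X = K := hκ
  replace hle : K * T - S ≤ T ^ 2 / 8 + K ^ 2 := hle
  have hT8 : (2 * (n : ℝ) - 1) ^ 2 / 8 * (T / (2 * n - 1)) ^ 2 = T ^ 2 / 8 := by
    field_simp
  rw [hric, key, hH, hκ, hφφ, hT8, hn]
  refine ⟨by linarith, Iff.trans ⟨fun h => ?_, fun h => ?_⟩ (hiff.trans ?_)⟩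
  · change K * T - S = T ^ 2 / 8 + K ^ 2
    linarith
  · replace h : K * T - S = T ^ 2 / 8 + K ^ 2 := h
    linarith
  · refine exists_congr fun e => exists_congr fun B => exists_congr fun μ =>
      and_congr_left' (forall_congr' fun i => forall_congr' fun j => ?_)
    exact Eq.congr_left (hind (e i) (e j))
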